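/- Graphs are finite. A signed graph $(G,\sigma)$ is a graph $G$ with a sign ($+$ or $-$) on each edge, where between two vertices there is at most one edge of each sign; at most one loop of each sign is allowed at each vertex. The sign of a walk is the product of the signs of its edges, with multiplicity. For $i,j\in\mathbb{Z}_2$ let $g_{ij}(G,\sigma)\in\mathbb{N}\cup\{\infty\}$ be the length of a shortest closed walk whose number of negative edges has parity $i$ and whose length has parity $j$. A homomorphism of signed graphs is a mapping of vertices to vertices and edges to edges that preserves adjacencies, incidences and the signs of closed walks. A signed graph $\hat B$ bounds a class $\mathcal{C}$ of signed graphs if every member of $\mathcal{C}$ admits a homomorphism to $\hat B$. For $k\ge 1$ let $C_{-k}$ be the cycle of length $k$ with exactly one negative edge ($C_{-1}$ is a negative loop, and $C_{-2}$ is the digon, that is, two vertices joined by a positive and a negative edge), and let $\mathcal{SP}_k$ be the class of signed planar graphs $(G,\sigma)$ with $g_{ij}(G,\sigma)\ge g_{ij}(C_{-k})$ for all $i,j\in\mathbb{Z}_2$. The extended double cover $EDC(G,\sigma)$ has two vertices $x_0,x_1$, joined by a negative edge, for each vertex $x$ of $G$; the positive edges $x_0y_0$, $x_1y_1$ for each positive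 edge $xy$; and the positive edges $x_0y_1$, $x_1y_0$ for each negative edge $xy$. The signed projective cubes are $SPC(1)$, the digon, and $SPC(k)=EDC(SPC(k-1))$ for $k\ge 2$. Theorem. (1) Let $k\ge 1$ and suppose that $SPC(i)$ bounds $\mathcal{SP}_{i+1}$ for every $1\le i\le k$. If a signed graph $\hat B$ (finite or infinite) bounds $\mathcal{SP}_l$ for some $1\le l\le k$, then $EDC(\hat B)$ bounds $\mathcal{SP}_{l+1}$. (2) The following two conjectures are equivalent: (a) for every $k\ge 1$ and every signed graph $\hat B$, if $\hat B$ bounds $\mathcal{SP}_k$, then $EDC(\hat B)$ bounds $\mathcal{SP}_{k+1}$; (b) for every $k\ge 2$, $SPC(k-1)$ bounds $\mathcal{SP}_k$. -/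

import Mathlib

universe u v

/-- A signed graph on the vertex set `V`. Signs are elements of `ZMod 2`: `0` is positive and `1` is
negative, so that the sign of a walk (a product of signs) is a sum in `ZMod 2`. `Adj s x y` says that
there is an edge of sign `s` between `x` and `y`; between two vertices there is thus at most one edge of
each sign, and a vertex carries at most one loop of each sign. -/
@[ext]
structure SignedGraph (V : Type u) where
  Adj : ZMod 2 → V → V → Prop
  symm : ∀ s x y, Adj s x y → Adj s y x

namespace SignedGraph

variable {V : Type u} {W : Type v}

/-- Walks, as sequences of signed edges. -/
inductive Walk (G : SignedGraph V) : V → V → Type u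
  | nil (x : V) : Walk G x x
  | cons {x y z : V} (s : ZMod 2) (h : G.Adj s x y) (p : Walk G y z) : Walk G x z

namespace Walk

/-- The number of edges of a walk, with multiplicity. -/
def length {G : SignedGraph V} : {x y : V} → G.Walk x y → ℕ
  | _, _, nil _ => 0
  | _, _, cons _ _ p => p.length + 1

/-- The sign of a walk, i.e. the parity of the number of its negative edges, with multiplicity. -/
def sign {G : SignedGraph V} : {x y : V} → G.Walk x y → ZMod 2
  | _, _, nil _ => 0
  | _, _, cons s _ p => s + p.sign

end Walk

/-- `g i j G` is the length of a shortest closed walk in which the number of negative edges has parity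
`i` and the length has parity `j`; it is `⊤` if there is no such walk. -/
noncomputable def g (i j : ZMod 2) (G : SignedGraph V) : ℕ∞ :=
  ⨅ (x : V) (p : G.Walk x x) (_ : p.sign = i ∧ (p.length : ZMod 2) = j), (p.length : ℕ∞)

/-- A mapping of vertices to vertices and edges to edges that preserves adjacencies and incidences.
The edge of sign `s` between `x` and `y` goes to the edge of sign `edgeSign s x y` between the images
of `x` and `y`. -/
structure GraphHom (G : SignedGraph V) (H : SignedGraph W) where
  toFun : V → W
  edgeSign : ZMod 2 → V → V → ZMod 2
  edgeSign_symm : ∀ s x y, G.Adj s x y → edgeSign s x y = edgeSign s y x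
  map_adj : ∀ s x y, G.Adj s x y → H.Adj (edgeSign s x y) (toFun x) (toFun y)

/-- The image of a walk. -/
def GraphHom.mapWalk {G : SignedGraph V} {H : SignedGraph W} (f : GraphHom G H) :
    {x y : V} → G.Walk x y → H.Walk (f.toFun x) (f.toFun y)
  | _, _, .nil x => .nil (f.toFun x)
  | _, _, .cons (x := x) (y := y) s h p =>
      .cons (f.edgeSign s x y) (f.map_adj s x y h) (f.mapWalk p)

/-- A homomorphism of signed graphs: a mapping of vertices and edges that preserves adjacencies,
incidences and the signs of closed walks. -/
structure Hom (G : SignedGraph V) (H : SignedGraph W) extends GraphHom G H where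
  sign_closed : ∀ (x : V) (p : G.Walk x x), (toGraphHom.mapWalk p).sign = p.sign

/-- The extended double cover. The vertices `x₀` and `x₁` are `(x, 0)` and `(x, 1)`; they are joined by
a negative edge. A positive edge `xy` gives the positive edges `x₀y₀` and `x₁y₁`, and a negative edge
`xy` gives the positive edges `x₀y₁` and `x₁y₀`. -/
def EDC (G : SignedGraph V) : SignedGraph (V × ZMod 2) where
  Adj s p q :=
    (s = 1 ∧ p.1 = q.1 ∧ p.2 ≠ q.2) ∨
    (s = 0 ∧ ((G.Adj 0 p.1 q.1 ∧ p.2 = q.2) ∨ (G.Adj 1 p.1 q.1 ∧ p.2 ≠ q.2)))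
  symm := by
    rintro s p q (⟨hs, h, h'⟩ | ⟨hs, ⟨h, h'⟩ | ⟨h, h'⟩⟩)
    · exact Or.inl ⟨hs, h.symm, h'.symm⟩
    · exact Or.inr ⟨hs, Or.inl ⟨G.symm _ _ _ h, h'.symm⟩⟩
    · exact Or.inr ⟨hs, Or.inr ⟨G.symm _ _ _ h, h'.symm⟩⟩

/-- The digon: two vertices joined by a positive and a negative edge. -/
def digon : SignedGraph (ZMod 2) where
  Adj _ x y := x ≠ y
  symm _ _ _ h := h.symm

/-- The negative cycle `C_{-k}` of length `k ≥ 1`: the edges join `i` to `i + 1` for `i` in `ZMod k`, and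
exactly the edge from `-1` to `0` is negative. `C_{-1}` is a negative loop and `C_{-2}` is the digon. -/
def negCycle (k : ℕ) : SignedGraph (ZMod k) where
  Adj s x y :=
    (y = x + 1 ∧ (s = 1 ↔ x = -1)) ∨ (x = y + 1 ∧ (s = 1 ↔ y = -1))
  symm _ _ _ h := h.symm

/-- The vertex set of the signed projective cube of dimension `k`. -/
def SPCVert : ℕ → Type
  | 0 => ZMod 1
  | 1 => ZMod 2
  | k + 2 => SPCVert (k + 1) × ZMod 2

/-- The signed projective cube of dimension `k`: the digon for `k = 1`, and the extended double cover of
the cube of dimension `k - 1` for `k ≥ 2`. (For `k = 0`, which is not used, it is a negative loop.) -/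
def SPC : (k : ℕ) → SignedGraph (SPCVert k)
  | 0 => negCycle 1
  | 1 => digon
  | k + 2 => EDC (SPC (k + 1))

/-- The underlying simple graph; loops and multiplicities of edges play no role for planarity. -/
def underlying (G : SignedGraph V) : SimpleGraph V where
  Adj x y := x ≠ y ∧ ∃ s, G.Adj s x y
  symm := ⟨fun _ _ h => ⟨h.1.symm, h.2.imp fun _ => G.symm _ _ _⟩⟩

end SignedGraph

/-- The cycles of a permutation, fixed points included. -/
abbrev Equiv.Perm.Cycles {D : Type*} (π : Equiv.Perm D) : Type _ :=
  Quotient (Equiv.Perm.SameCycle.setoid π)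

/-- A cellular embedding of a connected finite multigraph with at least one edge in the sphere, given
combinatorially by its set `D` of darts (edges with a direction). `rot` sends a dart to the next dart
around its initial vertex, `rev` reverses the direction of a dart, and `face` traverses the faces. The
vertices, edges and faces are the cycles of `rot`, `rev` and `face`; that the surface is the sphere is
Euler's formula `#V - #E + #F = 2`. -/
structure SphericalMap (D : Type) where
  rot : Equiv.Perm D
  rev : Equiv.Perm D
  face : Equiv.Perm D
  rev_rev : ∀ d, rev (rev d) = d
  rev_ne : ∀ d, rev d ≠ d
  rot_rev_face : rot * rev * face = 1
  connected : ∀ d e, ∃ π ∈ Subgroup.closure {rot, rev}, π d = e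
  euler : Nat.card rot.Cycles + Nat.card face.Cycles = Nat.card rev.Cycles + 2

/-- The vertex of a spherical map from which the dart `d` starts. -/
def SphericalMap.vert {D : Type} (M : SphericalMap D) (d : D) : M.rot.Cycles :=
  Quotient.mk _ d

/-- A finite simple graph is planar if it is (isomorphic to) a subgraph of a multigraph embedded in the
sphere. -/
def SimpleGraph.Planar {V : Type u} (G : SimpleGraph V) : Prop :=
  ∃ (D : Type) (_ : Finite D) (M : SphericalMap D) (f : V → M.rot.Cycles),
    Function.Injective f ∧
      ∀ x y, G.Adj x y → ∃ d, M.vert d = f x ∧ M.vert (M.rev d) = f y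

namespace SignedGraph

/-- The class `SP k` of finite signed planar graphs `G` with `g i j G ≥ g i j (C_{-k})` for all `i`, `j`. -/
def SP (k : ℕ) (V : Type) (G : SignedGraph V) : Prop :=
  Finite V ∧ G.underlying.Planar ∧ ∀ i j, g i j (negCycle k) ≤ g i j G

/-- `B` bounds the class `C` if every member of `C` admits a homomorphism to `B`. -/
def Bounds {W : Type v} (B : SignedGraph W) (C : (V : Type) → SignedGraph V → Prop) : Prop :=
  ∀ (V : Type) (G : SignedGraph V), C V G → Nonempty (Hom G B)

/-- The planar projective-cube conjecture: for every `k ≥ 2`, the cube of dimension `k - 1` bounds the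
class `SP k`. -/
def ProjectiveCubeConjecture : Prop :=
  ∀ k, 2 ≤ k → Bounds (SPC (k - 1)) (SP k)

/-- The extended double cover conjecture: for every `k ≥ 1` and every finite signed graph `B`, if `B`
bounds `SP k` then its extended double cover bounds `SP (k + 1)`. -/
def EDCConjecture : Prop :=
  ∀ k, 1 ≤ k → ∀ (W : Type) (_ : Finite W) (B : SignedGraph W),
    Bounds B (SP k) → Bounds B.EDC (SP (k + 1))

end SignedGraph

/-! ### Cycles of a permutation multiplied by a transposition -/

namespace Equiv.Perm

variable {D : Type*}

/-! Let `G` lie in `SP (m + 2)`, let `f` be a homomorphism from `G` to `(SPC m).EDC`, and let `B`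
bound `SP (m + 1)`. Contract every edge that `f` sends to a negative edge, and give each remaining
edge the sign of the base edge below its image. Projecting `f` maps the contraction to `SPC m`,
whose closed walks obey the constraints of `SP (m + 1)` (`walkBound_SPC`). Contraction keeps
planarity (`SimpleGraph.Planar.quotient`), so the contraction maps to `B`. This map lifts to a map
from `G` to `B.EDC` (`Hom.nonempty_hom_EDC_of_contract`): the edge signs are those of `f`, and the
layer of a vertex is its layer under `f`, corrected by a switching.

This gives (1), and (1) gives (b) ⇒ (a). For (a) ⇒ (b), iterate the double cover from the negative
loop `SPC 0`, which bounds `SP 1`.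

Planarity is handled on combinatorial maps: multiplying the rotation by a transposition merges the
two ends of an edge, leaving it as a loop. One vertex is lost and one face gained, so Euler's
formula survives. -/

theorem sameCycle_of_forall_apply {π : Perm D} {r : D → D → Prop} (hr : Equivalence r)
    (h : ∀ x, r x (π x)) {x y : D} (hxy : π.SameCycle x y) : r x y := by
  obtain ⟨n, rfl⟩ := hxy
  induction n using Int.induction_on with
  | zero => exact hr.refl x
  | succ n ih =>
    rw [add_comm, zpow_add, zpow_one, mul_apply]
    exact hr.trans ih (h _)
  | pred n ih =>
    refine hr.trans ih (hr.symm ?_)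
    have := h ((π ^ (-(n : ℤ) - 1)) x)
    rwa [← mul_apply, ← zpow_one_add, add_sub_cancel] at this

variable [DecidableEq D]

/-- The product sends `a` to `π b` and then follows the `π`-cycle of `b`, which avoids `a`, until it
reaches `b`. -/
theorem sameCycle_mul_swap_self [Finite D] {π : Perm D} {a b : D} (hab : ¬ π.SameCycle a b) :
    (π * swap a b).SameCycle a b := by
  have key : ∀ n : ℕ, (π * swap a b).SameCycle a b ∨
      (π * swap a b).SameCycle a ((π ^ (n + 1)) b) := by
    intro n
    induction n with
    | zero =>
      right
      refine ⟨1, ?_⟩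
      simp
    | succ n ih =>
      rcases ih with ih | ih
      · exact Or.inl ih
      by_cases hb : (π ^ (n + 1)) b = b
      · rw [hb] at ih
        exact Or.inl ih
      have ha : (π ^ (n + 1)) b ≠ a := fun h => hab (SameCycle.symm ⟨(n + 1 : ℕ), by rwa [zpow_natCast]⟩)
      right
      refine ih.trans ⟨1, ?_⟩
      rw [zpow_one, mul_apply, swap_apply_of_ne_of_ne ha hb, pow_succ' π (n + 1), mul_apply]
  have hpos : 0 < orderOf π := orderOf_pos π
  rcases key (orderOf π - 1) with h | h
  · exact h
  · rwa [Nat.sub_add_cancel hpos, pow_orderOf_eq_one, one_apply] at h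

theorem SameCycle.mul_swap [Finite D] {π : Perm D} {a b : D} (hab : ¬ π.SameCycle a b) {x y : D}
    (h : π.SameCycle x y) : (π * swap a b).SameCycle x y := by
  have hs := sameCycle_mul_swap_self hab
  refine sameCycle_of_forall_apply (SameCycle.equivalence _) (fun x => ?_) h
  by_cases ha : x = a
  · subst ha
    exact hs.trans ⟨1, by simp⟩
  by_cases hb : x = b
  · subst hb
    exact hs.symm.trans ⟨1, by simp⟩
  exact ⟨1, by simp [swap_apply_of_ne_of_ne ha hb]⟩

/-- Multiplying by a transposition of points in different cycles merges the two cycles. -/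
theorem sameCycle_mul_swap_iff [Finite D] {π : Perm D} {a b : D} (hab : ¬ π.SameCycle a b)
    {x y : D} : (π * swap a b).SameCycle x y ↔ π.SameCycle x y ∨
      (π.SameCycle a x ∨ π.SameCycle b x) ∧ (π.SameCycle a y ∨ π.SameCycle b y) := by
  constructor
  · intro h
    refine sameCycle_of_forall_apply (r := fun x y => π.SameCycle x y ∨
      (π.SameCycle a x ∨ π.SameCycle b x) ∧ (π.SameCycle a y ∨ π.SameCycle b y)) ⟨?_, ?_, ?_⟩ ?_ h
    · exact fun x => Or.inl (SameCycle.refl π x)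
    · rintro x y (h | h)
      · exact Or.inl h.symm
      · exact Or.inr h.symm
    · rintro x y z (h | ⟨h, h'⟩) (k | ⟨k, k'⟩)
      · exact Or.inl (h.trans k)
      · exact Or.inr ⟨k.imp (fun t => t.trans h.symm) (fun t => t.trans h.symm), k'⟩
      · exact Or.inr ⟨h, h'.imp (fun t => t.trans k) (fun t => t.trans k)⟩
      · exact Or.inr ⟨h, k'⟩
    · intro x
      by_cases ha : x = a
      · subst ha
        exact Or.inr ⟨Or.inl (SameCycle.refl _ _), Or.inr ⟨1, by simp⟩⟩
      by_cases hb : x = b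
      · subst hb
        exact Or.inr ⟨Or.inr (SameCycle.refl _ _), Or.inl ⟨1, by simp⟩⟩
      exact Or.inl ⟨1, by simp [swap_apply_of_ne_of_ne ha hb]⟩
  · have hs := sameCycle_mul_swap_self hab
    have key : ∀ z, π.SameCycle a z ∨ π.SameCycle b z → (π * swap a b).SameCycle a z := by
      rintro z (h | h)
      · exact h.mul_swap hab
      · exact hs.trans (h.mul_swap hab)
    rintro (h | ⟨h, h'⟩)
    · exact h.mul_swap hab
    · exact (key x h).symm.trans (key y h')

/-- The old cycles other than that of `a` biject with the new ones, the cycle of `b` standing for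
the merged cycle. -/
theorem card_cycles_mul_swap [Finite D] {π : Perm D} {a b : D} (hab : ¬ π.SameCycle a b) :
    Nat.card (π * swap a b).Cycles + 1 = Nat.card π.Cycles := by
  classical
  let ca : π.Cycles := Quotient.mk _ a
  let F : π.Cycles → (π * swap a b).Cycles :=
    Quotient.map' id fun _ _ h => SameCycle.mul_swap hab h
  have hF : Function.Bijective fun c : {c : π.Cycles // c ≠ ca} => F c.1 := by
    constructor
    · rintro ⟨c, hc⟩ ⟨d, hd⟩ h
      induction c using Quotient.inductionOn with | _ x
      induction d using Quotient.inductionOn with | _ y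
      have hx : ¬ π.SameCycle a x := fun h => hc (Quotient.sound h.symm)
      have hy : ¬ π.SameCycle a y := fun h => hd (Quotient.sound h.symm)
      have hxy : (π * swap a b).SameCycle x y := Quotient.exact h
      rw [sameCycle_mul_swap_iff hab] at hxy
      refine Subtype.ext (Quotient.sound ?_)
      rcases hxy with h | ⟨h | h, h' | h'⟩
      · exact h
      · exact absurd h hx
      · exact absurd h hx
      · exact absurd h' hy
      · exact h.symm.trans h'
    · intro c
      induction c using Quotient.inductionOn with | _ x
      by_cases hx : π.SameCycle a x
      · refine ⟨⟨Quotient.mk _ b, fun h => hab (Quotient.exact h).symm⟩, Quotient.sound ?_⟩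
        exact (sameCycle_mul_swap_iff hab).2
          (Or.inr ⟨Or.inr (SameCycle.refl _ _), Or.inl hx⟩)
      · exact ⟨⟨Quotient.mk _ x, fun h => hx (Quotient.exact h).symm⟩, rfl⟩
  rw [← Nat.card_congr (Equiv.ofBijective _ hF), ← Finite.card_option]
  exact Nat.card_congr (Equiv.optionSubtypeNe ca)

/-- Multiplying by the transposition of `p` and `π p` splits off the fixed point `p`. -/
theorem card_cycles_swap_apply_mul [Finite D] {π : Perm D} {p : D} (hp : π p ≠ p) :
    Nat.card (swap p (π p) * π).Cycles = Nat.card π.Cycles + 1 := by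
  have hfix : (swap p (π p) * π) p = p := by simp
  have hne : ¬ (swap p (π p) * π).SameCycle p (π⁻¹ p) := by
    intro h
    have := h.eq_of_left hfix
    exact hp (by rw [Perm.eq_inv_iff_eq] at this; exact this)
  -- Conjugation by `π` turns one transposition into the other, so `π` arises from the split
  -- permutation by a merge and the previous count applies.
  have hmul : swap p (π p) * π * swap p (π⁻¹ p) = π := by
    have : swap p (π⁻¹ p) = π⁻¹ * swap p (π p) * π := by
      have := swap_apply_apply π⁻¹ (π p) p
      rw [show π⁻¹ (π p) = p from π.symm_apply_apply p, inv_inv] at this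
      rw [this, swap_comm]
    rw [this, mul_assoc π⁻¹, mul_assoc, mul_inv_cancel_left, swap_mul_self_mul]
  rw [← card_cycles_mul_swap hne, hmul]

end Equiv.Perm

/-! ### Contracting edges of a spherical map -/

namespace SphericalMap

open Equiv.Perm

variable {D : Type}

theorem exists_mem_closure_of_sameCycle {π ρ : Equiv.Perm D} {d e : D} (h : π.SameCycle d e) :
    ∃ τ ∈ Subgroup.closure {π, ρ}, τ d = e := by
  obtain ⟨n, hn⟩ := h
  exact ⟨π ^ n, Subgroup.zpow_mem _ (Subgroup.subset_closure (by simp)) n, hn⟩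

/-- Transitivity of the group generated by two permutations, in terms of equivalence relations. -/
theorem forall_exists_mem_closure_of {π ρ π' : Equiv.Perm D}
    (h : ∀ d e, ∃ τ ∈ Subgroup.closure {π, ρ}, τ d = e)
    (hπ : ∀ d, π'.SameCycle d (π d)) (d e : D) :
    ∃ τ ∈ Subgroup.closure {π', ρ}, τ d = e := by
  obtain ⟨τ, hτ, rfl⟩ := h d e
  induction hτ using Subgroup.closure_induction generalizing d with
  | mem x hx =>
    rcases hx with rfl | rfl
    · exact exists_mem_closure_of_sameCycle (hπ d)
    · exact ⟨_, Subgroup.subset_closure (by simp), rfl⟩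
  | one => exact ⟨1, Subgroup.one_mem _, rfl⟩
  | mul x y _ _ hx hy =>
    obtain ⟨s, hs, hs'⟩ := hy d
    obtain ⟨t, ht, ht'⟩ := hx (y d)
    exact ⟨t * s, Subgroup.mul_mem _ ht hs, by simp [hs', ht']⟩
  | inv x _ hx =>
    obtain ⟨t, ht, ht'⟩ := hx (x⁻¹ d)
    refine ⟨t⁻¹, Subgroup.inv_mem _ ht, ?_⟩
    rw [Equiv.Perm.inv_eq_iff_eq, ht']
    simp

/-- The ends of an edge can be identified, the edge becoming a loop. -/
theorem exists_identify_ends [Finite D] (M : SphericalMap D) (e : D) :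
    ∃ M' : SphericalMap D, M'.rev = M.rev ∧
      (∀ x y, M.rot.SameCycle x y → M'.rot.SameCycle x y) ∧ M'.rot.SameCycle e (M.rev e) ∧
      ∀ r : D → D → Prop, Equivalence r → (∀ x y, M.rot.SameCycle x y → r x y) →
        r e (M.rev e) → ∀ x y, M'.rot.SameCycle x y → r x y := by
  classical
  by_cases he : M.rot.SameCycle e (M.rev e)
  · exact ⟨M, rfl, fun _ _ h => h, he, fun r _ h _ => h⟩
  have hface : M.face = M.rev * M.rot⁻¹ := by
    have h1 : M.rev⁻¹ = M.rev := by
      ext d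
      rw [Equiv.Perm.inv_eq_iff_eq, M.rev_rev]
    rw [eq_inv_of_mul_eq_one_right M.rot_rev_face, mul_inv_rev, h1]
  have hrev : M.rev * M.rev = 1 := by
    ext d
    simp [M.rev_rev]
  set b := M.rot⁻¹ (M.rev e) with hb
  have hbe : M.rot.SameCycle b (M.rev e) := ⟨1, by simp [hb]⟩
  have hab : ¬ M.rot.SameCycle e b := fun h => he (h.trans hbe)
  have hfe : M.face (M.rev e) = M.rev b := by simp [hface, hb]
  have hfne : M.face (M.rev e) ≠ M.rev e := by
    rw [hfe]
    intro h
    exact hab (by rw [M.rev.injective h])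
  have hsame := fun x y => sameCycle_mul_swap_iff hab (x := x) (y := y)
  refine ⟨⟨M.rot * Equiv.swap e b, M.rev, Equiv.swap (M.rev e) (M.face (M.rev e)) * M.face,
    M.rev_rev, M.rev_ne, ?_, ?_, ?_⟩, rfl, ?_, ?_, ?_⟩
  · have : Equiv.swap (M.rev e) (M.rev b) = M.rev * Equiv.swap e b * M.rev⁻¹ :=
      Equiv.swap_apply_apply M.rev e b
    rw [hfe, this, hface]
    have h1 : M.rev⁻¹ = M.rev := inv_eq_of_mul_eq_one_left hrev
    rw [h1]
    calc _ = M.rot * Equiv.swap e b * (M.rev * M.rev) * Equiv.swap e b * (M.rev * M.rev) *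
        M.rot⁻¹ := by group
      _ = _ := by simp [hrev, mul_assoc]
  · exact forall_exists_mem_closure_of M.connected
      fun d => SameCycle.mul_swap hab ⟨1, by simp⟩
  · have h1 := card_cycles_mul_swap hab
    have h2 := card_cycles_swap_apply_mul hfne
    have h3 := M.euler
    omega
  · exact fun x y h => h.mul_swap hab
  · exact (hsame _ _).2 (Or.inr ⟨Or.inl (SameCycle.refl _ _), Or.inr hbe⟩)
  · intro r hr hrot hre x y hxy
    have key : ∀ z, M.rot.SameCycle e z ∨ M.rot.SameCycle b z → r e z := by
      rintro z (h | h)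
      · exact hrot _ _ h
      · exact hr.trans hre (hrot _ _ (hbe.symm.trans h))
    rcases (hsame x y).1 hxy with h | ⟨h, h'⟩
    · exact hrot _ _ h
    · exact hr.trans (hr.symm (key x h)) (key y h')

/-- The last clause, minimality among equivalence relations, ensures that no unwanted vertices are
identified; injectivity after contraction rests on it. -/
theorem exists_identify_ends_of_finset [Finite D] (M : SphericalMap D) (L : Finset D) :
    ∃ M' : SphericalMap D, M'.rev = M.rev ∧
      (∀ x y, M.rot.SameCycle x y → M'.rot.SameCycle x y) ∧
      (∀ e ∈ L, M'.rot.SameCycle e (M.rev e)) ∧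
      ∀ r : D → D → Prop, Equivalence r → (∀ x y, M.rot.SameCycle x y → r x y) →
        (∀ e ∈ L, r e (M.rev e)) → ∀ x y, M'.rot.SameCycle x y → r x y := by
  classical
  induction L using Finset.induction_on with
  | empty => exact ⟨M, rfl, fun _ _ h => h, by simp, fun r _ h _ => h⟩
  | insert a L _ ih =>
    obtain ⟨N, hrev, hrot, hL, hr⟩ := ih
    obtain ⟨P, hrev', hrot', he, hr'⟩ := N.exists_identify_ends a
    refine ⟨P, hrev'.trans hrev, fun x y h => hrot' _ _ (hrot _ _ h), ?_, ?_⟩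
    · intro e he'
      rcases Finset.mem_insert.1 he' with rfl | he'
      · rwa [hrev] at he
      · exact hrot' _ _ (hL e he')
    · intro r hre h1 h2
      refine hr' r hre (hr r hre h1 fun e he => h2 e (Finset.mem_insert_of_mem he)) ?_
      rw [hrev]
      exact h2 a (Finset.mem_insert_self _ _)

end SphericalMap

/-- Planarity is preserved by contracting edges. -/
theorem SimpleGraph.Planar.quotient {V : Type u} {G : SimpleGraph V} (hG : G.Planar)
    {R : V → V → Prop} (hR : ∀ x y, R x y → x = y ∨ G.Adj x y)
    {H : SimpleGraph (Quotient (Relation.EqvGen.setoid R))}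
    (hH : ∀ X Y, H.Adj X Y → ∃ x y, Quotient.mk _ x = X ∧ Quotient.mk _ y = Y ∧ G.Adj x y) :
    H.Planar := by
  classical
  obtain ⟨D, hD, M, f, hf, hadj⟩ := hG
  have := Fintype.ofFinite D
  obtain ⟨M', hrev, hrot, hL, hmin⟩ := M.exists_identify_ends_of_finset
    (Finset.univ.filter fun d => ∃ x y, R x y ∧ M.vert d = f x ∧ M.vert (M.rev d) = f y)
  let F : M.rot.Cycles → M'.rot.Cycles := Quotient.map' id hrot
  have hF : ∀ d, F (M.vert d) = M'.vert d := fun _ => rfl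
  have hwd : ∀ x y, Relation.EqvGen R x y → F (f x) = F (f y) := by
    intro x y h
    induction h with
    | rel x y h =>
      rcases hR x y h with rfl | h'
      · rfl
      obtain ⟨d, hd, hd'⟩ := hadj x y h'
      rw [← hd, ← hd', hF, hF]
      exact Quotient.sound (hL d (by simpa using ⟨x, y, h, hd, hd'⟩))
    | refl => rfl
    | symm _ _ _ ih => exact ih.symm
    | trans _ _ _ _ _ ih ih' => exact ih.trans ih'
  refine ⟨D, hD, M', Quotient.lift (fun x => F (f x)) hwd, ?_, ?_⟩
  · intro X Y h
    induction X using Quotient.inductionOn with | _ x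
    induction Y using Quotient.inductionOn with | _ y
    obtain ⟨d, hd⟩ := Quotient.exists_rep (f x)
    obtain ⟨e, he⟩ := Quotient.exists_rep (f y)
    replace hd : M.vert d = f x := hd
    replace he : M.vert e = f y := he
    have hde : M'.rot.SameCycle d e := by
      have : F (f x) = F (f y) := h
      rw [← hd, ← he, hF, hF] at this
      exact Quotient.exact this
    -- The first alternative is needed for darts at vertices outside the range of `f`.
    have key := hmin (fun d e => M.vert d = M.vert e ∨
      ∃ x y, M.vert d = f x ∧ M.vert e = f y ∧ Relation.EqvGen R x y) ⟨?_, ?_, ?_⟩ ?_ ?_ d e hde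
    · apply Quotient.sound
      rcases key with h | ⟨x', y', h1, h2, h3⟩
      · rw [hd, he] at h
        exact hf h ▸ Relation.EqvGen.refl x
      · rw [hf (hd.symm.trans h1), hf (he.symm.trans h2)]
        exact h3
    · exact fun _ => Or.inl rfl
    · rintro _ _ (h | ⟨x, y, h1, h2, h3⟩)
      · exact Or.inl h.symm
      · exact Or.inr ⟨y, x, h2, h1, h3.symm⟩
    · rintro _ _ _ (h | ⟨x, y, h1, h2, h3⟩) (k | ⟨x', y', k1, k2, k3⟩)
      · exact Or.inl (h.trans k)
      · exact Or.inr ⟨x', y', h.trans k1, k2, k3⟩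
      · exact Or.inr ⟨x, y, h1, k.symm.trans h2, h3⟩
      · obtain rfl := hf (h2.symm.trans k1)
        exact Or.inr ⟨x, y', h1, k2, h3.trans _ _ _ k3⟩
    · exact fun _ _ h => Or.inl (Quotient.sound h)
    · intro d hd
      obtain ⟨x, y, h, h1, h2⟩ := (Finset.mem_filter.1 hd).2
      exact Or.inr ⟨x, y, h1, h2, .rel _ _ h⟩
  · intro X Y h
    obtain ⟨x, y, rfl, rfl, hxy⟩ := hH X Y h
    obtain ⟨d, hd, hd'⟩ := hadj x y hxy
    refine ⟨d, ?_, ?_⟩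
    · change M'.vert d = F (f x)
      rw [← hd, hF]
    · change M'.vert (M'.rev d) = F (f y)
      rw [← hd', hF, hrev]

namespace SignedGraph

variable {V : Type u} {W : Type v}

/-! ### Walks -/

namespace Walk

variable {G : SignedGraph V}

/-- Concatenation of walks. -/
def append : {x y z : V} → G.Walk x y → G.Walk y z → G.Walk x z
  | _, _, _, nil _, q => q
  | _, _, _, cons s h p, q => cons s h (p.append q)

theorem sign_append {x y z : V} (p : G.Walk x y) (q : G.Walk y z) :
    (p.append q).sign = p.sign + q.sign := by
  induction p with
  | nil => simp [append, sign]
  | cons s h p ih => simp [append, sign, ih, add_assoc]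

theorem nonempty_symm {x y : V} (p : G.Walk x y) : Nonempty (G.Walk y x) := by
  induction p with
  | nil x => exact ⟨nil x⟩
  | cons s h p ih =>
    obtain ⟨q⟩ := ih
    exact ⟨q.append (cons s (G.symm _ _ _ h) (nil _))⟩

end Walk

section GraphHom

variable {G : SignedGraph V} {H : SignedGraph W}

theorem GraphHom.mapWalk_append (f : GraphHom G H) {x y z : V} (p : G.Walk x y) (q : G.Walk y z) :
    f.mapWalk (p.append q) = (f.mapWalk p).append (f.mapWalk q) := by
  induction p with
  | nil => rfl
  | cons s h p ih => simp [Walk.append, GraphHom.mapWalk, ih]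

theorem GraphHom.length_mapWalk (f : GraphHom G H) {x y : V} (p : G.Walk x y) :
    (f.mapWalk p).length = p.length := by
  induction p with
  | nil => rfl
  | cons s h p ih => simp [Walk.length, GraphHom.mapWalk, ih]

theorem GraphHom.sign_mapWalk_congr {X : Type*} {K : SignedGraph X} (f : GraphHom G H)
    (f' : GraphHom G K) (h : ∀ s x y, G.Adj s x y → f.edgeSign s x y = f'.edgeSign s x y)
    {x y : V} (p : G.Walk x y) : (f.mapWalk p).sign = (f'.mapWalk p).sign := by
  induction p with
  | nil => rfl
  | cons s hs p ih => simp [Walk.sign, GraphHom.mapWalk, ih, h _ _ _ hs]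

/-- A mapping of the vertices that preserves signed adjacency is a homomorphism. -/
def Hom.ofAdj (f : V → W) (hf : ∀ s x y, G.Adj s x y → H.Adj s (f x) (f y)) : Hom G H where
  toFun := f
  edgeSign s _ _ := s
  edgeSign_symm _ _ _ _ := rfl
  map_adj := hf
  sign_closed x p := by
    have : ∀ {x y : V} (p : G.Walk x y), (GraphHom.mapWalk
        (⟨f, fun s _ _ => s, fun _ _ _ _ => rfl, hf⟩ : GraphHom G H) p).sign = p.sign := by
      intro x y p
      induction p with
      | nil => rfl
      | cons s h p ih => simp [Walk.sign, GraphHom.mapWalk, ih]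
    exact this p

/-- Post-composition of a homomorphism with a mapping that preserves signed adjacency. -/
def Hom.compAdj {X : Type*} {K : SignedGraph X} (f : Hom G H) (t : W → X)
    (ht : ∀ s x y, H.Adj s x y → K.Adj s (t x) (t y)) : Hom G K where
  toFun x := t (f.toFun x)
  edgeSign := f.edgeSign
  edgeSign_symm := f.edgeSign_symm
  map_adj s x y h := ht _ _ _ (f.map_adj s x y h)
  sign_closed x p := by
    rw [← f.sign_closed x p]
    refine GraphHom.sign_mapWalk_congr _ f.toGraphHom ?_ p
    exact fun _ _ _ _ => rfl

/-- A homomorphism preserves the signs of the edges up to a switching. -/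
theorem Hom.exists_switching (f : Hom G H) :
    ∃ δ : V → ZMod 2, ∀ s x y, G.Adj s x y → f.edgeSign s x y = s + δ x + δ y := by
  classical
  let S : Setoid V := ⟨fun x y => Nonempty (G.Walk x y), fun x => ⟨.nil x⟩,
    fun ⟨p⟩ => p.nonempty_symm, fun ⟨p⟩ ⟨q⟩ => ⟨p.append q⟩⟩
  let rep : V → V := fun x => (Quotient.mk S x).out
  have hrep : ∀ x, Nonempty (G.Walk x (rep x)) := fun x =>
    S.symm (Quotient.mk_out (s := S) x)
  -- The sign change along a walk depends only on its ends, since it vanishes on closed walks. It is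
  -- therefore a potential difference, and `δ` measures it to a base point of each component.
  let c : ∀ {x y : V}, G.Walk x y → ZMod 2 := fun p => (f.mapWalk p).sign + p.sign
  have hc : ∀ {x y : V} (p q : G.Walk x y), c p = c q := by
    intro x y p q
    obtain ⟨r⟩ := p.nonempty_symm
    have hp := f.sign_closed _ (p.append r)
    have hq := f.sign_closed _ (q.append r)
    rw [GraphHom.mapWalk_append, Walk.sign_append, Walk.sign_append] at hp hq
    simp only [c]
    generalize (f.mapWalk p).sign = a at *
    generalize (f.mapWalk q).sign = b at *
    generalize (f.mapWalk r).sign = d at *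
    generalize p.sign = a' at *
    generalize q.sign = b' at *
    generalize r.sign = d' at *
    revert a b d a' b' d'
    decide
  let δ : V → ZMod 2 := fun x => c (hrep x).some
  refine ⟨δ, fun s x y h => ?_⟩
  have hxy : rep x = rep y := by
    have : Quotient.mk S x = Quotient.mk S y := Quotient.sound ⟨.cons s h (.nil y)⟩
    simp only [rep, this]
  have key : ∀ z, z = rep y → ∀ p : G.Walk x z, c p = f.edgeSign s x y + s + δ y := by
    rintro z rfl p
    rw [hc p (.cons s h (hrep y).some)]
    simp only [c, δ, GraphHom.mapWalk, Walk.sign]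
    ring
  have hx : δ x = f.edgeSign s x y + s + δ y := key _ hxy (hrep x).some
  rw [hx]
  generalize f.edgeSign s x y = a
  generalize δ y = b
  linear_combination -CharTwo.add_self_eq_zero s - CharTwo.add_self_eq_zero b

end GraphHom

/-! ### Closed walks in `C_{-k}` and in the projective cubes -/

/-- The closed walks of `G` satisfy the constraints that define the class `SP k`. -/
def WalkBound (k : ℕ) (G : SignedGraph V) : Prop :=
  ∀ (x : V) (p : G.Walk x x), (p.sign = 0 ∧ (p.length : ZMod 2) = 0) ∨
    (p.sign = 1 ∧ k ≤ p.length ∧ (p.length : ZMod 2) = k)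

theorem WalkBound.of_hom {k : ℕ} {G : SignedGraph V} {H : SignedGraph W} (hH : WalkBound k H)
    (f : Hom G H) : WalkBound k G := by
  intro x p
  have := hH _ (f.mapWalk p)
  rwa [f.sign_closed, GraphHom.length_mapWalk] at this

/-- Step upwards from `-n` to `0`; only the last edge is negative. For `n = k` the walk is the whole
cycle. -/
theorem exists_walk_negCycle (k n : ℕ) (hn : 1 ≤ n) (hnk : n ≤ k) :
    ∃ p : (negCycle k).Walk (-(n : ZMod k)) 0, p.length = n ∧ p.sign = 1 := by
  induction n, hn using Nat.le_induction with
  | base =>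
    have h : (negCycle k).Adj 1 (-((1 : ℕ) : ZMod k)) 0 := Or.inl (by simp)
    exact ⟨.cons 1 h (.nil 0), by simp [Walk.length], by simp [Walk.sign]⟩
  | succ n hn ih =>
    obtain ⟨p, hp, hs⟩ := ih (by omega)
    refine ⟨.cons 0 (Or.inl ⟨?_, ?_⟩) p, ?_, ?_⟩
    · push_cast
      ring
    · have : (n : ZMod k) ≠ 0 := by
        rw [Ne, ZMod.natCast_eq_zero_iff]
        exact fun h => absurd (Nat.le_of_dvd hn h) (by omega)
      simp only [zero_ne_one, false_iff]
      intro h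
      apply this
      push_cast at h
      linear_combination -h
    · simp [Walk.length, hp]
    · simp [Walk.sign, hs]

theorem g_le_length {G : SignedGraph V} {x : V} (p : G.Walk x x) {i j : ZMod 2} (hi : p.sign = i)
    (hj : (p.length : ZMod 2) = j) : g i j G ≤ p.length :=
  iInf_le_of_le x (iInf_le_of_le p (iInf_le _ ⟨hi, hj⟩))

theorem WalkBound.g_le {k : ℕ} (hk : 1 ≤ k) {G : SignedGraph V} (hG : WalkBound k G)
    (i j : ZMod 2) : g i j (negCycle k) ≤ g i j G := by
  refine le_iInf fun x => le_iInf fun p => le_iInf fun hp => ?_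
  obtain ⟨rfl, rfl⟩ := hp
  rcases hG x p with ⟨hs, hl⟩ | ⟨hs, hle, hl⟩
  · refine (g_le_length (G := negCycle k) (Walk.nil 0) ?_ ?_).trans ?_
    · simp [hs, Walk.sign]
    · simp [hl, Walk.length]
    · simp [Walk.length]
  · obtain ⟨q, hq, hqs⟩ : ∃ q : (negCycle k).Walk 0 0, q.length = k ∧ q.sign = 1 := by
      have := exists_walk_negCycle k k hk le_rfl
      rwa [ZMod.natCast_self, neg_zero] at this
    refine (g_le_length q (hqs.trans hs.symm) (by rw [hl, hq])).trans ?_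
    rw [hq]
    exact_mod_cast hle

theorem sign_eq_length_of_walk_negCycle_one {x y : ZMod 1} (p : (negCycle 1).Walk x y) :
    p.sign = (p.length : ZMod 2) := by
  induction p with
  | nil => simp [Walk.sign, Walk.length]
  | @cons x y z s h p ih =>
    have hs : s = 1 := by
      rcases h with ⟨_, h⟩ | ⟨_, h⟩
      · exact h.2 (Subsingleton.elim _ _)
      · exact h.2 (Subsingleton.elim _ _)
    simp [Walk.sign, Walk.length, ih, hs, add_comm]

theorem walkBound_negCycle_one : WalkBound 1 (negCycle 1) := by
  intro x p
  have h := sign_eq_length_of_walk_negCycle_one p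
  have h2 : ∀ a : ZMod 2, a = 0 ∨ a = 1 := by decide
  rcases h2 p.sign with hs | hs
  · exact Or.inl ⟨hs, h ▸ hs⟩
  · refine Or.inr ⟨hs, ?_, by rw [← h, hs]; simp⟩
    rw [Nat.one_le_iff_ne_zero]
    intro h0
    rw [h0, hs] at h
    simp at h

/-- A walk in the extended double cover projects to a walk in the base. -/
theorem exists_walk_of_walk_EDC {H : SignedGraph W} {a b : W × ZMod 2} (p : H.EDC.Walk a b) :
    ∃ (q : H.Walk a.1 b.1) (n : ℕ), p.length = q.length + n ∧ p.sign = n ∧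
      a.2 + b.2 = q.sign + n := by
  have hadd : ∀ a b : ZMod 2, a ≠ b → a = b + 1 := by decide
  induction p with
  | nil a => exact ⟨.nil _, 0, rfl, rfl, by simp [Walk.sign, CharTwo.add_self_eq_zero]⟩
  | @cons a b c s h p ih =>
    obtain ⟨q, n, h1, h2, h3⟩ := ih
    obtain ⟨a1, a2⟩ := a
    obtain ⟨b1, b2⟩ := b
    rcases h with ⟨rfl, h, h'⟩ | ⟨rfl, ⟨h, h'⟩ | ⟨h, h'⟩⟩
    · obtain rfl : a1 = b1 := h
      refine ⟨q, n + 1, ?_, ?_, ?_⟩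
      · simp [Walk.length, h1, add_assoc]
      · simp [Walk.sign, h2, add_comm]
      · have := hadd _ _ h'
        simp only at this h3 ⊢
        rw [this]
        push_cast
        linear_combination h3
    · refine ⟨.cons 0 h q, n, ?_, ?_, ?_⟩
      · simp only [Walk.length, h1]
        ring
      · simp [Walk.sign, h2]
      · simp only at h' h3 ⊢
        rw [h', h3]
        simp [Walk.sign]
    · refine ⟨.cons 1 h q, n, ?_, ?_, ?_⟩
      · simp only [Walk.length, h1]
        ring
      · simp [Walk.sign, h2]
      · have := hadd _ _ h'
        simp only [Walk.sign] at this h3 ⊢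
        rw [this]
        linear_combination h3

/-- A closed walk changes layer an even number of times, so its projection has the same sign. If
that sign is negative, at least one negative edge was dropped, which accounts for the extra unit of
length. -/
theorem WalkBound.EDC {k : ℕ} {H : SignedGraph W} (hH : WalkBound k H) :
    WalkBound (k + 1) H.EDC := by
  intro x p
  obtain ⟨q, n, h1, h2, h3⟩ := exists_walk_of_walk_EDC p
  have hq : q.sign = (n : ZMod 2) := by
    rw [CharTwo.add_self_eq_zero] at h3
    exact (CharTwo.add_eq_zero.1 h3.symm)
  rw [h1, h2]
  rcases hH _ q with ⟨hs, hl⟩ | ⟨hs, hle, hl⟩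
  · left
    rw [hq] at hs
    simp [hs, hl]
  · right
    rw [hq] at hs
    refine ⟨hs, ?_, by simp [hs, hl]⟩
    have : n ≠ 0 := by
      rintro rfl
      simp at hs
    omega

theorem negCycle_one_adj_iff (s : ZMod 2) (x y : ZMod 1) : (negCycle 1).Adj s x y ↔ s = 1 := by
  simp [negCycle, eq_iff_true_of_subsingleton]

/-- The negative loop contributes the positive edge between the layers, so its double cover is the
digon. -/
theorem EDC_negCycle_one_adj_iff (s : ZMod 2) (x y : ZMod 1 × ZMod 2) :
    (negCycle 1).EDC.Adj s x y ↔ x.2 ≠ y.2 := by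
  have : s = 0 ∨ s = 1 := by revert s; decide
  rcases this with rfl | rfl <;>
    simp [EDC, negCycle_one_adj_iff, eq_iff_true_of_subsingleton]

/-- The projective cube of dimension `m + 1` is the extended double cover of the one of dimension
`m`, also for `m = 0`. -/
theorem nonempty_hom_SPC_succ_iff (m : ℕ) (G : SignedGraph V) :
    Nonempty (Hom G (SPC (m + 1))) ↔ Nonempty (Hom G (SPC m).EDC) := by
  cases m with
  | succ m => exact Iff.rfl
  | zero =>
    constructor
    · rintro ⟨f⟩
      exact ⟨f.compAdj (K := (negCycle 1).EDC) (fun x => ((0 : ZMod 1), (x : ZMod 2)))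
        fun s x y h => (EDC_negCycle_one_adj_iff s _ _).2 h⟩
    · rintro ⟨f⟩
      exact ⟨f.compAdj (H := (negCycle 1).EDC) (K := digon) Prod.snd
        fun s x y h => (EDC_negCycle_one_adj_iff s x y).1 h⟩

theorem walkBound_SPC (m : ℕ) : WalkBound (m + 1) (SPC m) := by
  induction m with
  | zero => exact walkBound_negCycle_one
  | succ m ih =>
    obtain ⟨f⟩ := (nonempty_hom_SPC_succ_iff m (SPC (m + 1))).1 ⟨Hom.ofAdj id fun _ _ _ h => h⟩
    exact ih.EDC.of_hom f

theorem finite_SPCVert : ∀ m, Finite (SPCVert m)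
  | 0 => inferInstanceAs (Finite (Fin 1))
  | 1 => inferInstanceAs (Finite (Fin 2))
  | m + 2 => by
    have := finite_SPCVert (m + 1)
    exact inferInstanceAs (Finite (SPCVert (m + 1) × ZMod 2))

/-! ### Contraction of the edges mapped to the negative edges of an extended double cover -/

section Contraction

variable {G : SignedGraph V} {H : SignedGraph W} (f : Hom G H.EDC)

/-- The edges mapped to negative edges. -/
def Hom.NegRel (x y : V) : Prop := ∃ s, G.Adj s x y ∧ f.edgeSign s x y = 1

/-- The vertices of the contraction. -/
abbrev Hom.ContractVert : Type u := Quotient (Relation.EqvGen.setoid f.NegRel)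

/-- The class of a vertex in the contraction. -/
def Hom.contractMk (x : V) : f.ContractVert := Quotient.mk _ x

/-- The contraction of the edges mapped to negative edges. The remaining edges get the signs of their
images in the base of the extended double cover. -/
def Hom.contract : SignedGraph f.ContractVert where
  Adj t X Y := ∃ s x y, f.contractMk x = X ∧ f.contractMk y = Y ∧ G.Adj s x y ∧
    f.edgeSign s x y = 0 ∧ t = (f.toFun x).2 + (f.toFun y).2
  symm := by
    rintro t X Y ⟨s, x, y, hx, hy, h, h0, ht⟩
    exact ⟨s, y, x, hy, hx, G.symm _ _ _ h, (f.edgeSign_symm s x y h).symm.trans h0,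
      ht.trans (add_comm _ _)⟩

theorem Hom.map_of_edgeSign_eq_one {s : ZMod 2} {x y : V} (h : G.Adj s x y)
    (h1 : f.edgeSign s x y = 1) :
    (f.toFun x).1 = (f.toFun y).1 ∧ (f.toFun x).2 ≠ (f.toFun y).2 := by
  have := f.map_adj s x y h
  rw [h1] at this
  simpa [EDC] using this

theorem Hom.map_of_edgeSign_eq_zero {s : ZMod 2} {x y : V} (h : G.Adj s x y)
    (h0 : f.edgeSign s x y = 0) :
    H.Adj ((f.toFun x).2 + (f.toFun y).2) (f.toFun x).1 (f.toFun y).1 := by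
  have hadd : ∀ a b : ZMod 2, a ≠ b → a + b = 1 := by decide
  have := f.map_adj s x y h
  rw [h0] at this
  rcases this with ⟨h, _⟩ | ⟨_, ⟨h, h'⟩ | ⟨h, h'⟩⟩
  · exact absurd h zero_ne_one
  · rwa [h', CharTwo.add_self_eq_zero]
  · rwa [hadd _ _ h']

/-- The contraction maps to the base. -/
theorem Hom.nonempty_hom_contract : Nonempty (Hom f.contract H) := by
  refine ⟨Hom.ofAdj (Quotient.lift (fun x => (f.toFun x).1) ?_) ?_⟩
  · intro x y h
    induction h with
    | rel x y h =>
      obtain ⟨s, h, h1⟩ := h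
      exact (f.map_of_edgeSign_eq_one h h1).1
    | refl => rfl
    | symm _ _ _ ih => exact ih.symm
    | trans _ _ _ _ _ ih ih' => exact ih.trans ih'
  · rintro t _ _ ⟨s, x, y, rfl, rfl, h, h0, rfl⟩
    exact f.map_of_edgeSign_eq_zero h h0

/-- The contraction of a planar graph is planar. -/
theorem Hom.planar_contract (hG : G.underlying.Planar) : f.contract.underlying.Planar := by
  refine hG.quotient (R := f.NegRel) ?_ ?_
  · rintro x y ⟨s, h, -⟩
    exact or_iff_not_imp_left.2 fun hxy => ⟨hxy, s, h⟩
  · rintro _ _ ⟨hne, t, s, x, y, rfl, rfl, h, -⟩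
    exact ⟨x, y, rfl, rfl, fun hxy => hne (by rw [hxy]), s, h⟩

/-- A homomorphism from the contraction lifts to the extended double cover. -/
theorem Hom.nonempty_hom_EDC_of_contract {X : Type*} {B : SignedGraph X} (h : Hom f.contract B) :
    Nonempty (Hom G B.EDC) := by
  obtain ⟨δ, hδ⟩ := h.exists_switching
  -- Adding `δ` makes the layer change along an uncontracted edge equal to the sign of its image in
  -- `B`. On a contracted edge both ends get the same shift, so they stay in opposite layers.
  refine ⟨⟨⟨fun x => (h.toFun (f.contractMk x), (f.toFun x).2 + δ (f.contractMk x)),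
    f.edgeSign, f.edgeSign_symm, fun s x y hs => ?_⟩, fun x p => ?_⟩⟩
  · have h2 : ∀ a : ZMod 2, a = 0 ∨ a = 1 := by decide
    rcases h2 (f.edgeSign s x y) with he | he
    · right
      have hadj : f.contract.Adj ((f.toFun x).2 + (f.toFun y).2) (f.contractMk x)
        (f.contractMk y) := ⟨s, x, y, rfl, rfl, hs, he, rfl⟩
      have hB := h.map_adj _ _ _ hadj
      have hsign := hδ _ _ _ hadj
      refine ⟨he, ?_⟩
      have hcase : ∀ a b c d : ZMod 2, a + b + c + d = 0 ∧ a + c = b + d ∨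
          a + b + c + d = 1 ∧ a + c ≠ b + d := by decide
      rcases hcase (f.toFun x).2 (f.toFun y).2 (δ (f.contractMk x)) (δ (f.contractMk y)) with
        ⟨k, k'⟩ | ⟨k, k'⟩
      · rw [hsign, k] at hB
        exact Or.inl ⟨hB, k'⟩
      · rw [hsign, k] at hB
        exact Or.inr ⟨hB, k'⟩
    · left
      have hxy : f.contractMk x = f.contractMk y :=
        Quotient.sound (Relation.EqvGen.rel _ _ ⟨s, hs, he⟩)
      refine ⟨he, by simp only [hxy], ?_⟩
      simp only [hxy]
      exact fun k => (f.map_of_edgeSign_eq_one hs he).2 (add_right_cancel k)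
  · rw [← f.sign_closed x p]
    refine GraphHom.sign_mapWalk_congr _ f.toGraphHom ?_ p
    exact fun _ _ _ _ => rfl

end Contraction

/-! ### Bounds -/

theorem Bounds.EDC_of_SPC {m : ℕ} (hm : Bounds (SPC (m + 1)) (SP (m + 2))) {B : SignedGraph W}
    (hB : Bounds B (SP (m + 1))) : Bounds B.EDC (SP (m + 2)) := by
  intro V G hG
  obtain ⟨f⟩ := (nonempty_hom_SPC_succ_iff m G).1 (hm V G hG)
  obtain ⟨hfin, hpl, -⟩ := hG
  obtain ⟨c⟩ := f.nonempty_hom_contract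
  obtain ⟨h⟩ := hB _ f.contract ⟨Quotient.finite _, f.planar_contract hpl,
    ((walkBound_SPC m).of_hom c).g_le (by omega)⟩
  exact f.nonempty_hom_EDC_of_contract h

/-- In `negCycle 1` sign equals length parity. Membership in `SP 1` forces the same for closed walks
of `G`, as the other two values of `g` are infinite. -/
theorem bounds_negCycle_one : Bounds (negCycle 1) (SP 1) := by
  intro V G ⟨_, _, hG⟩
  let F : GraphHom G (negCycle 1) := ⟨fun _ => 0, fun _ _ _ => 1, fun _ _ _ _ => rfl,
    fun _ _ _ _ => (negCycle_one_adj_iff _ _ _).2 rfl⟩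
  refine ⟨⟨F, fun x p => ?_⟩⟩
  rw [sign_eq_length_of_walk_negCycle_one, GraphHom.length_mapWalk]
  by_contra hne
  have htop : g p.sign p.length (negCycle 1) = ⊤ := by
    simp only [g, iInf_eq_top]
    rintro y q ⟨h1, h2⟩
    rw [← h1, ← h2, sign_eq_length_of_walk_negCycle_one q] at hne
    exact absurd rfl hne
  have := (hG p.sign p.length).trans (g_le_length p rfl rfl)
  rw [htop] at this
  simp at this

theorem EDCConjecture.bounds_SPC (h : EDCConjecture) (m : ℕ) : Bounds (SPC m) (SP (m + 1)) := by
  induction m with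
  | zero => exact bounds_negCycle_one
  | succ m ih =>
    intro V G hG
    exact (nonempty_hom_SPC_succ_iff m G).2
      (h (m + 1) (by omega) _ (finite_SPCVert m) _ ih V G hG)

end SignedGraph

open SignedGraph in
theorem mainTheorem2 :
    (∀ k : ℕ, (∀ i, 1 ≤ i → i ≤ k → Bounds (SPC i) (SP (i + 1))) →
      ∀ l, 1 ≤ l → l ≤ k → ∀ (W : Type u) (B : SignedGraph W),
        Bounds B (SP l) → Bounds B.EDC (SP (l + 1))) ∧
    (EDCConjecture ↔ ProjectiveCubeConjecture) := by
  refine ⟨fun k hk l hl hlk W B hB => ?_, fun h k hk => ?_, fun h k hk W _ B hB => ?_⟩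
  · obtain ⟨m, rfl⟩ := Nat.exists_eq_add_of_le' hl
    exact Bounds.EDC_of_SPC (hk _ hl hlk) hB
  · obtain ⟨m, rfl⟩ := Nat.exists_eq_add_of_le' hk
    exact h.bounds_SPC (m + 1)
  · obtain ⟨m, rfl⟩ := Nat.exists_eq_add_of_le' hk
    exact Bounds.EDC_of_SPC (h (m + 2) (by omega)) hB
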